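/- Let $T$ be a tree, meaning a directed acyclic graph on $[n]=\{1,\dots,n\}$ whose edges $i\to j$ all satisfy $i<j$ and whose underlying undirected graph is a tree. A trek from $i$ to $j$ is a simple path $P$ between $i$ and $j$ in $T$ (edges may be traversed in either direction) that contains no two distinct edges $u\to k$, $w\to k$ with the same head; $\mathrm{top}(P)$ is the vertex of $P$ into which no edge of $P$ points, and $T(i,j)$ is the set of treks from $i$ to $j$ (it has at most one element, and $T(i,i)$ consists of the empty trek). Let $$\phi_T:\ \mathbb{C}[\sigma_{ij}\mid 1\le i\le j\le n]\to\mathbb{C}[a_i,\lambda_{kl}\mid i\in[n],\ k\to l\in E(T)],\qquad \sigma_{ij}\mapsto\sum_{P\in T(i,j)}a_{\mathrm{top}(P)}\prod_{k\to l\in P}\lambda_{kl},$$ let $I_T=\ker\phi_T$, let $A_T$ be the set of the exponent vectors $\mathbf a_{ij}\in\mathbb{Z}^{2n-1}$ of the monomials $\phi_T(\sigma_{ij})$ for the pairs $i\le j$ with $T(i,j)\neq\emptyset$, and let $P_T=\mathrm{conv}(A_T)$. Let $\prec$ be any (graded) reverse lexicographic term order on $\mathbb{C}[\sigma_{ij}]$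 such that $\sigma_{ii}\succ\sigma_{jk}$ for all $i$ and all $j<k$. Then: 1. the initial ideal $\mathrm{in}_\prec(I_T)$ is a squarefree monomial ideal; 2. the associated pulling triangulation of $P_T$ is unimodular, i.e. the vertices of each of its maximal simplices form a $\mathbb{Z}$-basis of the lattice $\mathbb{Z}A_T$. Here the pulling triangulation is the one in which the points $\mathbf a_{ij}$ are pulled in the order of the variables $\sigma_{ij}$, $\prec$-smallest first: the maximal simplices of the triangulation of a nonempty face $F$ are the joins of the $\prec$-smallest point $v$ of $A_T\cap F$ with the maximal simplices of the pulling triangulations of the facets of $F$ not containing $v$, where the only maximal simplex of the empty face is the empty one. -/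

import Mathlib

open scoped MonomialOrder

namespace GaussianDAG

/-! ### Directed acyclic graphs and treks -/

/-- A directed acyclic graph on the vertices `0, …, n - 1` that is numerically ordered:
`i → j` is an edge only if `i < j`. -/
structure DAG (n : ℕ) extends Digraph (Fin n) where
  lt_of_adj : ∀ i j : Fin n, Adj i j → i < j

variable {n : ℕ}

/-- The underlying undirected graph. -/
abbrev DAG.skeleton (G : DAG n) : SimpleGraph (Fin n) :=
  G.toDigraph.toSimpleGraphInclusive

/-- A tree is a DAG whose underlying undirected graph is a tree (a polytree). -/
def DAG.IsTree (G : DAG n) : Prop := G.skeleton.IsTree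

/-- The type of directed edges `i → j` of `G`. -/
abbrev DAG.Edge (G : DAG n) : Type := {e : Fin n × Fin n // G.Adj e.1 e.2}

/-- The directed edge `k → l` of `G` is traversed (in either direction) by the walk `p`. -/
def DAG.Uses (G : DAG n) {i j : Fin n} (p : G.skeleton.Walk i j) (k l : Fin n) : Prop :=
  G.Adj k l ∧ s(k, l) ∈ p.edges

/-- `T(i, j)`: the simple paths from `i` to `j` in `G` (edges may be traversed in either
direction) without a collider, that is, without two distinct edges `u → k`, `w → k`. -/
def DAG.Trek (G : DAG n) (i j : Fin n) : Type :=
  {p : G.skeleton.Path i j //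
    ∀ u w k : Fin n, G.Uses p.1 u k → G.Uses p.1 w k → u = w}

noncomputable instance (G : DAG n) (i j : Fin n) : Fintype (G.Trek i j) := by
  classical
  unfold DAG.Trek
  infer_instance

variable {G : DAG n} {i j : Fin n}

/-- The walk underlying a trek. -/
def DAG.Trek.walk (P : G.Trek i j) : G.skeleton.Walk i j := P.1.1

theorem DAG.Trek.exists_top (P : G.Trek i j) :
    ∃ t ∈ P.walk.support, ∀ k : Fin n, ¬ G.Uses P.walk k t := by
  obtain ⟨t, ht, hmin⟩ := P.walk.support.toFinset.exists_min_image id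
    ⟨i, by simp⟩
  refine ⟨t, by simpa using ht, fun k hk => ?_⟩
  have h1 : k ∈ P.walk.support := P.walk.fst_mem_support_of_mem_edges hk.2
  exact absurd (hmin k (by simpa using h1)) (not_le.2 (G.lt_of_adj _ _ hk.1))

/-- The topmost vertex of a trek: the vertex of the trek into which no edge of the trek
points. -/
noncomputable def DAG.Trek.top (P : G.Trek i j) : Fin n := P.exists_top.choose

/-! ### The parametrization and its ideal -/

/-- The index set `{(i, j) : i ≤ j}` of the variables `σ_ij`. -/
abbrev SigmaVar (n : ℕ) : Type := {p : Fin n × Fin n // p.1 ≤ p.2}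

/-- The index set of the parameters: `a_i` for the vertices `i`, `λ_kl` for the edges
`k → l`. -/
abbrev DAG.Param (G : DAG n) : Type := Fin n ⊕ G.Edge

open scoped Classical in
/-- The monomial `a_top(P) * ∏_{k → l ∈ P} λ_kl` of a trek `P`. -/
noncomputable def DAG.Trek.monomial (P : G.Trek i j) : MvPolynomial G.Param ℂ :=
  MvPolynomial.X (Sum.inl P.top) *
    ∏ e : G.Edge with G.Uses P.walk e.1.1 e.1.2, MvPolynomial.X (Sum.inr e)

/-- The trek rule homomorphism `φ_G`, `σ_ij ↦ ∑_{P ∈ T(i,j)} a_top(P) ∏_{k → l ∈ P} λ_kl`. -/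
noncomputable def DAG.phi (G : DAG n) :
    MvPolynomial (SigmaVar n) ℂ →ₐ[ℂ] MvPolynomial G.Param ℂ :=
  MvPolynomial.aeval fun p => ∑ P : G.Trek p.1.1 p.1.2, P.monomial

/-- The ideal `I_G = ker φ_G`. -/
noncomputable def DAG.ideal (G : DAG n) : Ideal (MvPolynomial (SigmaVar n) ℂ) :=
  RingHom.ker G.phi

/-! ### Term orders and initial ideals -/

/-- `m` is the (graded) reverse lexicographic term order for the order it induces on the
variables: `x^a ≺ x^b` if and only if `deg a < deg b`, or the degrees agree and, for the
`≺`-smallest variable `x_i` whose exponents in `x^a` and `x^b` differ, `a_i > b_i`. -/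
def IsRevLex {σ : Type*} (m : MonomialOrder σ) : Prop :=
  ∀ a b : σ →₀ ℕ, a ≺[m] b ↔
    a.degree < b.degree ∨
      a.degree = b.degree ∧ ∃ i : σ, b i < a i ∧
        ∀ j : σ, Finsupp.single j 1 ≺[m] Finsupp.single i 1 → a j = b j

/-- The initial ideal `in_≺(I)`, generated by the leading terms of the elements of `I`. -/
noncomputable def initialIdeal {σ k : Type*} [CommSemiring k] (m : MonomialOrder σ)
    (I : Ideal (MvPolynomial σ k)) : Ideal (MvPolynomial σ k) :=
  Ideal.span (m.leadingTerm '' (I : Set (MvPolynomial σ k)))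

/-- `I` is a squarefree monomial ideal: it is generated by monomials all of whose exponents
are at most `1`. -/
def IsSquarefreeMonomialIdeal {σ k : Type*} [CommSemiring k]
    (I : Ideal (MvPolynomial σ k)) : Prop :=
  ∃ S : Set (σ →₀ ℕ), (∀ s ∈ S, ∀ i, s i ≤ 1) ∧
    I = Ideal.span ((fun s => MvPolynomial.monomial s (1 : k)) '' S)

/-! ### Pulling triangulations of lattice point configurations -/

section Pulling

variable {ι κ : Type*}

/-- The point `a_i` of an integral configuration, as a real vector. -/
def realPoint (a : ι → κ → ℤ) (i : ι) : κ → ℝ := fun x => (a i x : ℝ)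

/-- The polytope `conv {a_i : i ∈ F}`. -/
def polytope (a : ι → κ → ℤ) (F : Set ι) : Set (κ → ℝ) :=
  convexHull ℝ (realPoint a '' F)

/-- `H` is the set of labels of the configuration points in `F` that lie on some face
(possibly empty, possibly improper) of the polytope `conv {a_i : i ∈ F}`. -/
def IsFace (a : ι → κ → ℤ) (F H : Finset ι) : Prop :=
  ∃ Q : Set (κ → ℝ), IsExposed ℝ (polytope a F) Q ∧
    ∀ i, i ∈ H ↔ i ∈ F ∧ realPoint a i ∈ Q

/-- `H` labels a facet of the polytope `conv {a_i : i ∈ F}`: a maximal proper face. -/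
def IsFacet (a : ι → κ → ℤ) (F H : Finset ι) : Prop :=
  IsFace a F H ∧ H ≠ F ∧ ∀ K, IsFace a F K → H ⊆ K → K = H ∨ K = F

/-- `IsPullingSimplex a r F S`: the set `S` labels the vertices of a maximal simplex of the
pulling triangulation of `conv {a_i : i ∈ F}` in which the points are pulled in the order `r`,
smallest first. Recursively, these simplices are the joins of the smallest point `v` of `F`
with the maximal simplices of the pulling triangulations of the facets that do not
contain `v`. -/
inductive IsPullingSimplex [DecidableEq ι] (a : ι → κ → ℤ) (r : ι → ι → Prop) :
    Finset ι → Finset ι → Prop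
  | empty : IsPullingSimplex a r ∅ ∅
  | pull {F H S : Finset ι} {v : ι} (hv : v ∈ F) (hmin : ∀ w ∈ F, w ≠ v → r v w)
      (hH : IsFacet a F H) (hvH : v ∉ H) (hS : IsPullingSimplex a r H S) :
      IsPullingSimplex a r F (insert v S)

/-- The simplex with vertices `a_i`, `i ∈ S`, is unimodular with respect to the lattice
`ℤA` spanned by the configuration `A = {a_i}` (whose points lie on an affine
hyperplane that misses the origin): its vertices form a `ℤ`-basis of `ℤA`. -/
def IsUnimodularSimplex (a : ι → κ → ℤ) (S : Finset ι) : Prop :=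
  LinearIndependent ℤ (fun i : S => a i) ∧
    Submodule.span ℤ (a '' S) = Submodule.span ℤ (Set.range a)

/-- The pulling triangulation of `conv {a_i}` with respect to the order `r` is unimodular. -/
def PullingUnimodular [Fintype ι] [DecidableEq ι] (a : ι → κ → ℤ)
    (r : ι → ι → Prop) : Prop :=
  ∀ S : Finset ι, IsPullingSimplex a r Finset.univ S → IsUnimodularSimplex a S

end Pulling

/-! ### The point configuration of a tree -/

open scoped Classical in
/-- The exponent vector of the monomial of a trek. -/
noncomputable def DAG.Trek.exponent (P : G.Trek i j) : G.Param → ℕ :=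
  Sum.elim (fun v => if v = P.top then 1 else 0)
    (fun e => if G.Uses P.walk e.1.1 e.1.2 then 1 else 0)

open scoped Classical in
theorem DAG.Trek.monomial_eq (P : G.Trek i j) :
    P.monomial = ∏ x : G.Param, MvPolynomial.X x ^ P.exponent x := by
  simp [DAG.Trek.monomial, DAG.Trek.exponent, Finset.prod_filter, Fintype.prod_sum_type,
    pow_ite, Finset.prod_ite_eq']

/-- The labels of the points `a_ij`: the pairs `i ≤ j` for which `T(i, j)` is nonempty. -/
abbrev DAG.TrekPair (G : DAG n) : Type :=
  {p : SigmaVar n // Nonempty (G.Trek p.1.1 p.1.2)}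

/-- The configuration `A_T`: the point `a_ij` is the exponent vector of the trek from `i` to
`j` (which is unique when `G` is a tree). The polytope `P_T` is the convex hull of these
points. -/
noncomputable def DAG.config (G : DAG n) (p : G.TrekPair) : G.Param → ℤ :=
  fun x => ((Classical.choice p.2).exponent x : ℤ)

end GaussianDAG

/-!
The polytope of a tree is described by functionals that count treks: `z ↦ z x` for the
parameters `x`, the number of ends at a vertex `v`, and the number of treks that pass through
the tail of an edge `e` without using `e`. An integral vector on which all of them are
nonnegative is a sum of trek vectors: remove a unit of weight from an edge into a lowest vertex,
decompose what is left, and put the unit back, either by prolonging a trek that ends at the tail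
of the edge or, if that trek already uses the edge, by first exchanging its end with that of a
trek that avoids the edge.

The point of `σ_ij` with `i < j` has value at most `1` under all functionals, so it can be
subtracted from every sum of points that is positive wherever the point is. Consequently a facet
that does not contain the point lies at lattice distance `1` from it, and in a binomial relation
whose smallest variable is `σ_ij`, the other side may be replaced by the product of the distinct
variables that occur in it. The points of the `σ_ii` may have value `2`. These variables come
last in the order, so that they are only pulled from faces all of whose points are unit vectors,
and they are never the smallest variable of a binomial relation.
-/

namespace GaussianDAG

section Faces

variable {ι κ : Type*} {a : ι → κ → ℤ} {F G H : Finset ι} {k : (κ → ℝ) →L[ℝ] ℝ}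

theorem realPoint_mem_polytope {s : Set ι} {i : ι} (hi : i ∈ s) :
    realPoint a i ∈ polytope a s :=
  subset_convexHull ℝ _ ⟨i, hi, rfl⟩

theorem nonneg_of_mem_polytope {s : Set ι} (hk : ∀ i ∈ s, 0 ≤ k (realPoint a i))
    {y : κ → ℝ} (hy : y ∈ polytope a s) : 0 ≤ k y := by
  refine convexHull_min (t := {y | 0 ≤ k y}) ?_
    (convex_halfSpace_ge k.toLinearMap.isLinear 0) hy
  rintro _ ⟨i, hi, rfl⟩
  exact hk i hi

/-- The linear functional `k` cuts out the face `H` of `F`: it is nonnegative on the points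
of `F`, and `H` labels the points of `F` where it vanishes. Using linear instead of affine
functionals is no restriction when the points lie on an affine hyperplane that misses the
origin. -/
structure CutsOut (a : ι → κ → ℤ) (k : (κ → ℝ) →L[ℝ] ℝ) (F H : Finset ι) : Prop where
  nonneg : ∀ i ∈ F, 0 ≤ k (realPoint a i)
  mem_iff : ∀ i, i ∈ H ↔ i ∈ F ∧ k (realPoint a i) = 0

theorem CutsOut.subset (h : CutsOut a k F H) : H ⊆ F := fun i hi => ((h.mem_iff i).1 hi).1

theorem CutsOut.eq_zero (h : CutsOut a k F H) {i : ι} (hi : i ∈ H) : k (realPoint a i) = 0 :=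
  ((h.mem_iff i).1 hi).2

theorem CutsOut.pos (h : CutsOut a k F H) {i : ι} (hi : i ∈ F) (hiH : i ∉ H) :
    0 < k (realPoint a i) :=
  (h.nonneg i hi).lt_of_ne fun h0 => hiH ((h.mem_iff i).2 ⟨hi, h0.symm⟩)

theorem CutsOut.isFace (h : CutsOut a k F H) : IsFace a F H := by
  rcases H.eq_empty_or_nonempty with rfl | ⟨i₀, hi₀⟩
  · exact ⟨∅, fun hne => absurd hne (by simp), fun i => by simp⟩
  have hpos : ∀ y ∈ polytope a (F : Set ι), 0 ≤ k y := fun y => nonneg_of_mem_polytope h.nonneg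
  refine ⟨{x ∈ polytope a F | ∀ y ∈ polytope a (F : Set ι), (-k) y ≤ (-k) x},
    fun _ => ⟨-k, rfl⟩, fun i => (h.mem_iff i).trans (and_congr_right fun hi => ?_)⟩
  constructor
  · intro hzero
    exact ⟨realPoint_mem_polytope hi, fun y hy => by simpa [hzero] using hpos y hy⟩
  · rintro ⟨-, hmax⟩
    have := hmax _ (realPoint_mem_polytope (h.subset hi₀))
    rw [neg_apply, neg_apply, h.eq_zero hi₀] at this
    linarith [h.nonneg i hi]

theorem IsFace.exists_cutsOut {d : (κ → ℝ) →L[ℝ] ℝ} (hd : ∀ i, d (realPoint a i) = 1)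
    (h : IsFace a F H) : ∃ k, CutsOut a k F H := by
  obtain ⟨Q, hQ, hH⟩ := h
  rcases Q.eq_empty_or_nonempty with rfl | hne
  · exact ⟨d, fun i _ => by simp [hd], fun i => by simp [hH, hd]⟩
  obtain ⟨l, rfl⟩ := hQ hne
  obtain ⟨x, hx, hmax⟩ := hne
  have hval : ∀ i, (l x • d - l) (realPoint a i) = l x - l (realPoint a i) := fun i => by
    simp [hd]
  have hle : ∀ i ∈ F, l (realPoint a i) ≤ l x := fun i hi => hmax _ (realPoint_mem_polytope hi)
  refine ⟨l x • d - l, fun i hi => ?_, fun i => (hH i).trans (and_congr_right fun hi => ?_)⟩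
  · rw [hval]
    exact sub_nonneg.2 (hle i hi)
  · rw [hval, sub_eq_zero]
    exact ⟨fun hi' => le_antisymm (hi'.2 x hx) (hle i hi),
      fun heq => ⟨realPoint_mem_polytope hi, fun y hy => heq ▸ hmax y hy⟩⟩

theorem IsFace.refl (a : ι → κ → ℤ) (F : Finset ι) : IsFace a F F :=
  CutsOut.isFace (k := 0) ⟨by simp, by simp⟩

theorem IsFace.trans {d : (κ → ℝ) →L[ℝ] ℝ} (hd : ∀ i, d (realPoint a i) = 1)
    (hG : IsFace a F G) (hH : IsFace a G H) : IsFace a F H := by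
  obtain ⟨f, hf⟩ := hG.exists_cutsOut hd
  obtain ⟨h, hh⟩ := hH.exists_cutsOut hd
  obtain ⟨N, hN⟩ : ∃ N : ℝ, ∀ i ∈ F, i ∉ G →
      0 < N * f (realPoint a i) + h (realPoint a i) := by
    refine ⟨∑ i ∈ F, (|h (realPoint a i)| + 1) / f (realPoint a i), fun i hi hiG => ?_⟩
    have hle := Finset.single_le_sum
      (f := fun i => (|h (realPoint a i)| + 1) / f (realPoint a i))
      (fun j hj => div_nonneg (by positivity) (hf.nonneg j hj)) hi
    rw [div_le_iff₀ (hf.pos hi hiG)] at hle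
    linarith [neg_abs_le (h (realPoint a i))]
  have hval : ∀ i, (N • f + h) (realPoint a i) =
      N * f (realPoint a i) + h (realPoint a i) := fun i => by simp
  refine CutsOut.isFace (k := N • f + h) ⟨fun i hi => ?_, fun i => ?_⟩ <;> rw [hval]
  · by_cases hiG : i ∈ G
    · simpa [hf.eq_zero hiG] using hh.nonneg i hiG
    · exact (hN i hi hiG).le
  · by_cases hiG : i ∈ G
    · simp [hh.mem_iff, hiG, hf.subset hiG, hf.eq_zero hiG]
    · simpa [hh.mem_iff, hiG] using fun hi => (hN i hi hiG).ne'

theorem IsFacet.exists_eq_mul (hH : IsFacet a F H) {h : (κ → ℝ) →L[ℝ] ℝ} (hh : CutsOut a h F H)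
    (hk : ∀ i ∈ H, k (realPoint a i) = 0) :
    ∃ c : ℝ, ∀ i ∈ F, k (realPoint a i) = c * h (realPoint a i) := by
  classical
  have hne : (F \ H).Nonempty :=
    Finset.sdiff_nonempty.2 fun hFH => hH.2.1 (hh.subset.antisymm hFH)
  obtain ⟨u, hu, hmax⟩ :=
    (F \ H).exists_max_image (fun i => k (realPoint a i) / h (realPoint a i)) hne
  rw [Finset.mem_sdiff] at hu
  set c := k (realPoint a u) / h (realPoint a u) with hc
  have hval : ∀ i, (c • h - k) (realPoint a i) =
      c * h (realPoint a i) - k (realPoint a i) := fun i => by simp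
  let K := F.filter fun i => (c • h - k) (realPoint a i) = 0
  have hK : CutsOut a (c • h - k) F K := by
    refine ⟨fun i hi => ?_, fun i => Finset.mem_filter⟩
    rw [hval]
    by_cases hiH : i ∈ H
    · simp [hk i hiH, hh.eq_zero hiH]
    · have hle := hmax i (Finset.mem_sdiff.2 ⟨hi, hiH⟩)
      rw [div_le_iff₀ (hh.pos hi hiH)] at hle
      exact sub_nonneg.2 hle
  have hHK : H ⊆ K := fun i hi =>
    (hK.mem_iff i).2 ⟨hh.subset hi, by simp [hk i hi, hh.eq_zero hi]⟩
  have huK : u ∈ K := by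
    refine (hK.mem_iff u).2 ⟨hu.1, ?_⟩
    rw [hval, hc, div_mul_cancel₀ _ (hh.pos hu.1 hu.2).ne', sub_self]
  have hKF : K = F := (hH.2.2 K hK.isFace hHK).resolve_left fun hKH => hu.2 (hKH ▸ huK)
  refine ⟨c, fun i hi => ?_⟩
  have := hK.eq_zero (hKF ▸ hi)
  rw [hval] at this
  linarith

theorem IsFacet.realPoint_mem_span [Finite κ] {d : (κ → ℝ) →L[ℝ] ℝ}
    (hd : ∀ i, d (realPoint a i) = 1) (hH : IsFacet a F H) {v i : ι} (hv : v ∈ F) (hvH : v ∉ H)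
    (hi : i ∈ F) :
    realPoint a i ∈ Submodule.span ℝ (insert (realPoint a v) (realPoint a '' H)) := by
  by_contra hnot
  obtain ⟨l, hl, hle⟩ := Submodule.exists_le_ker_of_notMem hnot
  have hzero : ∀ x ∈ insert (realPoint a v) (realPoint a '' H), l x = 0 := fun x hx =>
    hle (Submodule.subset_span hx)
  obtain ⟨h, hh⟩ := hH.1.exists_cutsOut hd
  obtain ⟨c, hc⟩ := hH.exists_eq_mul (k := LinearMap.toContinuousLinearMap l) hh
    fun j hj => hzero _ (.inr ⟨j, hj, rfl⟩)
  have hc0 : c = 0 := by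
    have hcv : 0 = c * h (realPoint a v) := (hzero _ (.inl rfl)).symm.trans (hc v hv)
    exact (mul_eq_zero.1 hcv.symm).resolve_right (hh.pos hv hvH).ne'
  exact hl ((hc i hi).trans (by simp [hc0]))

end Faces

section Pulling

variable {ι κ : Type*} {a : ι → κ → ℤ} {r : ι → ι → Prop}

theorem exists_continuousLinearMap_eq_intCast [Finite κ] (f : (κ → ℤ) →+ ℤ) :
    ∃ l : (κ → ℝ) →L[ℝ] ℝ, ∀ z : κ → ℤ, l (fun x => (z x : ℝ)) = f z := by
  classical
  cases nonempty_fintype κ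
  refine ⟨∑ x, (f (Pi.single x 1) : ℝ) • ContinuousLinearMap.proj x, fun z => ?_⟩
  conv_rhs => rw [← Finset.univ_sum_single z, map_sum]
  rw [sum_apply, Int.cast_sum]
  refine Finset.sum_congr rfl fun x _ => ?_
  rw [← mul_one (z x), ← smul_eq_mul (z x), Pi.single_smul, map_zsmul]
  simp [mul_comm]

/-- If the point `v` precedes all points of a face `H` that does not contain it, then some
integral functional vanishes on `H` and has value one at `v`. Hence pulling `v` joins it to
facets at lattice distance one. -/
def PullsAtHeightOne [Fintype ι] (a : ι → κ → ℤ) (r : ι → ι → Prop) : Prop :=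
  ∀ (H : Finset ι) (v : ι), IsFace a Finset.univ H → v ∉ H → (∀ w ∈ H, r v w) →
    ∃ g : (κ → ℤ) →+ ℤ, g (a v) = 1 ∧ ∀ i ∈ H, g (a i) = 0

theorem IsFacet.sub_smul_mem_span [Finite κ] {F H : Finset ι} {v : ι} {d : (κ → ℝ) →L[ℝ] ℝ}
    (hd : ∀ i, d (realPoint a i) = 1) (hH : IsFacet a F H) (hv : v ∈ F) (hvH : v ∉ H)
    {g : (κ → ℤ) →+ ℤ} (hgv : g (a v) = 1) (hgH : ∀ i ∈ H, g (a i) = 0) {z : κ → ℤ}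
    (hz : (fun x => (z x : ℝ)) ∈ Submodule.span ℝ (realPoint a '' F)) :
    (fun x => ((z - g z • a v) x : ℝ)) ∈ Submodule.span ℝ (realPoint a '' H) := by
  obtain ⟨l, hl⟩ := exists_continuousLinearMap_eq_intCast g
  have hspan : Submodule.span ℝ (realPoint a '' F) ≤
      Submodule.span ℝ (insert (realPoint a v) (realPoint a '' H)) := by
    rw [Submodule.span_le]
    rintro _ ⟨i, hi, rfl⟩
    exact hH.realPoint_mem_span hd hv hvH hi
  obtain ⟨c, y, hy, hzy⟩ := Submodule.mem_span_insert.1 (hspan hz)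
  have hly : l y = 0 := by
    refine Submodule.span_le (p := LinearMap.ker l.toLinearMap).2 ?_ hy
    rintro _ ⟨i, hi, rfl⟩
    exact (hl (a i)).trans (by simp [hgH i hi])
  have hc : (g z : ℝ) = c := by
    have hlv : l (realPoint a v) = 1 := (hl (a v)).trans (by simp [hgv])
    rw [← hl, hzy, map_add, map_smul, hlv, hly, smul_eq_mul, mul_one, add_zero]
  convert hy using 1
  ext x
  have := congrFun hzy x
  simp only [Pi.add_apply, Pi.smul_apply, smul_eq_mul, realPoint] at this
  simp [this, hc]

variable [DecidableEq ι]

theorem IsPullingSimplex.subset {F S : Finset ι} {d : (κ → ℝ) →L[ℝ] ℝ}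
    (hd : ∀ i, d (realPoint a i) = 1) (hS : IsPullingSimplex a r F S) : S ⊆ F := by
  induction hS with
  | empty => rfl
  | pull hv _ hH _ _ ih =>
    obtain ⟨k, hk⟩ := hH.1.exists_cutsOut hd
    exact Finset.insert_subset hv (ih.trans hk.subset)

theorem linearIndepOn_insert_of_eq_one {V : Type*} [AddCommGroup V] {a : ι → V} {S : Finset ι}
    {v : ι} (hS : LinearIndepOn ℤ a (S : Set ι)) {g : V →+ ℤ} (hv : g (a v) = 1)
    (hg : ∀ i ∈ S, g (a i) = 0) : LinearIndepOn ℤ a (insert v S : Finset ι) := by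
  have hvS : v ∉ S := fun h => by simp [hg v h] at hv
  rw [linearIndepOn_finset_iff] at hS ⊢
  intro w hw
  rw [Finset.sum_insert hvS] at hw
  have hwv : w v = 0 := by
    have := congrArg g hw
    rwa [map_add, map_zsmul, hv, map_sum, Finset.sum_eq_zero fun i hi => by
      rw [map_zsmul, hg i hi, smul_zero], add_zero, smul_eq_mul, mul_one, map_zero] at this
  rw [hwv, zero_smul, zero_add] at hw
  exact (Finset.forall_mem_insert _ _ _).2 ⟨hwv, hS w hw⟩

theorem IsPullingSimplex.linearIndepOn_and_mem_span [Fintype ι] [Finite κ]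
    {d : (κ → ℝ) →L[ℝ] ℝ} (hd : ∀ i, d (realPoint a i) = 1) (ha : PullsAtHeightOne a r)
    {F S : Finset ι} (hS : IsPullingSimplex a r F S) (hF : IsFace a Finset.univ F) :
    LinearIndepOn ℤ a (S : Set ι) ∧ ∀ z : κ → ℤ,
      (fun x => (z x : ℝ)) ∈ Submodule.span ℝ (realPoint a '' F) →
        z ∈ Submodule.span ℤ (a '' S) := by
  induction hS with
  | empty =>
    refine ⟨by simp, fun z hz => ?_⟩
    have hz0 : z = 0 := by
      ext x
      simpa using congrFun (by simpa using hz : (fun x => (z x : ℝ)) = 0) x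
    simp [hz0]
  | @pull F H S v hv hmin hH hvH hS ih =>
    have hHface := hF.trans hd hH.1
    obtain ⟨k, hk⟩ := hH.1.exists_cutsOut hd
    obtain ⟨hindep, hmem⟩ := ih hHface
    obtain ⟨g, hgv, hgH⟩ := ha H v hHface hvH fun w hw =>
      hmin w (hk.subset hw) (ne_of_mem_of_not_mem hw hvH)
    refine ⟨linearIndepOn_insert_of_eq_one hindep hgv fun i hi => hgH i (hS.subset hd hi),
      fun z hz => ?_⟩
    rw [Finset.coe_insert, Set.image_insert_eq, Submodule.mem_span_insert]
    exact ⟨g z, z - g z • a v, hmem _ (hH.sub_smul_mem_span hd hv hvH hgv hgH hz), by abel⟩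

theorem PullsAtHeightOne.pullingUnimodular [Fintype ι] [Finite κ] {d : (κ → ℤ) →+ ℤ}
    (hd : ∀ i, d (a i) = 1) (ha : PullsAtHeightOne a r) : PullingUnimodular a r := by
  intro S hS
  obtain ⟨l, hl⟩ := exists_continuousLinearMap_eq_intCast d
  obtain ⟨hindep, hmem⟩ := hS.linearIndepOn_and_mem_span (d := l)
    (fun i => (hl (a i)).trans (by simp [hd])) ha (.refl a _)
  refine ⟨hindep, (Submodule.span_mono (Set.image_subset_range _ _)).antisymm ?_⟩
  rw [Submodule.span_le]
  rintro _ ⟨i, rfl⟩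
  exact hmem _ (Submodule.subset_span ⟨i, by simp, rfl⟩)

end Pulling

section NearlyCompressed

variable {ι γ V : Type*} [AddCommGroup V] {a : ι → V}

theorem nonneg_of_mem_closure_range {M : Type*} [AddMonoid M] [Preorder M] [AddLeftMono M]
    {h : V →+ M} (hh : ∀ i, 0 ≤ h (a i)) {z : V} (hz : z ∈ AddSubmonoid.closure (Set.range a)) :
    0 ≤ h z := by
  induction hz using AddSubmonoid.closure_induction with
  | mem _ hx => obtain ⟨i, rfl⟩ := hx; exact hh i
  | zero => simp
  | add x y _ _ hx hy => simpa using add_nonneg hx hy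

theorem mem_closure_range_iff_exists_linearCombination {z : V} :
    z ∈ AddSubmonoid.closure (Set.range a) ↔ ∃ b, Finsupp.linearCombination ℕ a b = z := by
  rw [← Submodule.span_nat_eq_addSubmonoidClosure, Submodule.mem_toAddSubmonoid,
    Finsupp.mem_span_range_iff_exists_finsupp]
  rfl

theorem map_linearCombination_pos_iff {M : Type*} [AddCommGroup M] [LinearOrder M]
    [IsOrderedAddMonoid M] {h : V →+ M} {b : ι →₀ ℕ} (hh : ∀ i, 0 ≤ h (a i)) :
    0 < h (Finsupp.linearCombination ℕ a b) ↔ ∃ i, b i ≠ 0 ∧ 0 < h (a i) := by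
  rw [Finsupp.linearCombination_apply, Finsupp.sum, map_sum,
    Finset.sum_pos_iff_of_nonneg fun i _ => by rw [map_nsmul]; exact nsmul_nonneg (hh i) _]
  refine exists_congr fun i => ?_
  rw [Finsupp.mem_support_iff, map_nsmul]
  exact and_congr_right fun hi => nsmul_pos_iff hi

/-- A configuration with a system `g` of integral functionals that cuts out the semigroup
generated by the configuration, such that every point outside of `D` has height at most `1`
with respect to `g`, and such that the points in `D` have dual functionals. For `D = ∅` these
are the compressed configurations; for trees, `D` consists of the variances `σ_ii`, whose
points may have height `2`. -/
structure IsNearlyCompressed (a : ι → V) (g : γ → V →+ ℤ) (D : Set ι) : Prop where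
  nonneg : ∀ c i, 0 ≤ g c (a i)
  generate : ∀ z, (∀ c, 0 ≤ g c z) → z ∈ AddSubmonoid.closure (Set.range a)
  height_le : ∀ i ∉ D, ∀ c, g c (a i) ≤ 1
  dual : ∀ i ∈ D, ∃ c, g c (a i) = 1 ∧ ∀ j ∈ D, j ≠ i → g c (a j) = 0

namespace IsNearlyCompressed

variable {g : γ → V →+ ℤ} {D : Set ι} {r : ι → ι → Prop}

theorem nonneg_of_mem_closure (ha : IsNearlyCompressed a g D) {z : V}
    (hz : z ∈ AddSubmonoid.closure (Set.range a)) (c : γ) : 0 ≤ g c z :=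
  nonneg_of_mem_closure_range (ha.nonneg c) hz

theorem sub_mem_closure (ha : IsNearlyCompressed a g D) {v : ι} (hv : v ∉ D) {z : V}
    (hz : z ∈ AddSubmonoid.closure (Set.range a)) (hpos : ∀ c, 0 < g c (a v) → 0 < g c z) :
    z - a v ∈ AddSubmonoid.closure (Set.range a) := by
  refine ha.generate _ fun c => ?_
  rw [map_sub]
  have := ha.nonneg_of_mem_closure hz c
  have := ha.height_le v hv c
  have := hpos c
  lia

theorem pullsAtHeightOne [Fintype ι] {κ : Type*} [Finite κ] {a : ι → κ → ℤ}
    {g : γ → (κ → ℤ) →+ ℤ} (ha : IsNearlyCompressed a g D) {d : (κ → ℤ) →+ ℤ}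
    (hd : ∀ i, d (a i) = 1) (hr : ∀ i j, r i j → ¬ r j i) (hD : ∀ i ∉ D, ∀ j ∈ D, r i j) :
    PullsAtHeightOne a r := by
  intro H v hH hvH hmin
  by_cases hvD : v ∈ D
  · obtain ⟨c, hcv, hc⟩ := ha.dual v hvD
    refine ⟨g c, hcv, fun i hi => hc i ?_ (ne_of_mem_of_not_mem hi hvH)⟩
    by_contra hiD
    exact hr _ _ (hmin i hi) (hD i hiD v hvD)
  by_contra! hcon
  have hmem : ∑ i ∈ H, a i - a v ∈ AddSubmonoid.closure (Set.range a) := by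
    refine ha.sub_mem_closure hvD
      (sum_mem fun i _ => AddSubmonoid.subset_closure ⟨i, rfl⟩) fun c hc => ?_
    obtain ⟨i, hi, hne⟩ := hcon (g c) (by have := ha.height_le v hvD c; lia)
    rw [map_sum, Finset.sum_pos_iff_of_nonneg fun i _ => ha.nonneg c i]
    exact ⟨i, hi, (ha.nonneg c i).lt_of_ne' hne⟩
  obtain ⟨l, hl⟩ := exists_continuousLinearMap_eq_intCast d
  obtain ⟨k, hk⟩ := hH.exists_cutsOut (d := l) fun i => (hl (a i)).trans (by simp [hd])
  let f : (κ → ℤ) →+ ℝ := (k : (κ → ℝ) →+ ℝ).comp ((Int.castAddHom ℝ).compLeft κ)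
  have hf : ∀ i, f (a i) = k (realPoint a i) := fun i => rfl
  have hnonneg : 0 ≤ f (∑ i ∈ H, a i - a v) :=
    nonneg_of_mem_closure_range (fun i => hk.nonneg i (Finset.mem_univ i)) hmem
  rw [map_sub, map_sum, Finset.sum_eq_zero fun i hi => (hf i).trans (hk.eq_zero hi), zero_sub,
    hf] at hnonneg
  linarith [hk.pos (Finset.mem_univ v) hvH]

theorem exists_squarefree_of_linearCombination_eq (ha : IsNearlyCompressed a g D)
    (hD : ∀ i ∉ D, ∀ j ∈ D, r i j) {u w : ι →₀ ℕ}
    (huw : Finsupp.linearCombination ℕ a u = Finsupp.linearCombination ℕ a w) {i : ι}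
    (hi : u i < w i) (hbelow : ∀ j, r j i → w j = u j) :
    ∃ s t : ι →₀ ℕ, s ≤ u ∧ (∀ j, s j ≤ 1) ∧
      Finsupp.linearCombination ℕ a s = Finsupp.linearCombination ℕ a t ∧ t i ≠ 0 ∧
        ∀ j, s j ≠ 0 → j ≠ i ∧ ¬ r j i := by
  classical
  have hpos : ∀ c b, 0 < g c (Finsupp.linearCombination ℕ a b) ↔ ∃ j, b j ≠ 0 ∧ 0 < g c (a j) :=
    fun c b => map_linearCombination_pos_iff (ha.nonneg c)
  have hcancel : Finsupp.linearCombination ℕ a (u - w) = Finsupp.linearCombination ℕ a (w - u) := by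
    have hsum : u - w + w = w - u + u := by ext j; simp; lia
    have := congrArg (Finsupp.linearCombination ℕ a) hsum
    rwa [map_add, map_add, huw, add_left_inj] at this
  have hbalance : ∀ c, 0 < g c (a i) → ∃ j, w j < u j ∧ 0 < g c (a j) := fun c hc => by
    obtain ⟨j, hj, hcj⟩ := (hpos c (u - w)).1 (hcancel ▸ (hpos c (w - u)).2
      ⟨i, by simpa [Nat.sub_eq_zero_iff_le] using hi, hc⟩)
    exact ⟨j, by simpa [Nat.sub_eq_zero_iff_le] using hj, hcj⟩
  have hiD : i ∉ D := fun hiD => by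
    obtain ⟨c, hci, hc⟩ := ha.dual i hiD
    obtain ⟨j, hj, hcj⟩ := hbalance c (by lia)
    by_cases hjD : j ∈ D
    · have hji : j ≠ i := by rintro rfl; lia
      exact hcj.ne' (hc j hjD hji)
    · exact hj.ne (hbelow j (hD j hjD i hiD))
  let s : ι →₀ ℕ := Finsupp.indicator (u - w).support fun _ _ => 1
  have hs : ∀ j, s j = if w j < u j then 1 else 0 := fun j => by
    simp [s, Finsupp.indicator_apply, Nat.sub_eq_zero_iff_le]
  obtain ⟨b, hb⟩ := mem_closure_range_iff_exists_linearCombination.1 <|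
    ha.sub_mem_closure hiD (mem_closure_range_iff_exists_linearCombination.2 ⟨s, rfl⟩)
      fun c hc => (hpos c s).2 <| (hbalance c hc).imp fun j hj => ⟨by simp [hs, hj.1], hj.2⟩
  refine ⟨s, Finsupp.single i 1 + b, fun j => ?_, fun j => ?_, ?_, by simp, fun j hj => ?_⟩
  · rw [hs]; split_ifs <;> lia
  · rw [hs]; split_ifs <;> lia
  · simp [hb]
  · have hwu : w j < u j := by
      by_contra hle
      exact hj (by rw [hs, if_neg hle])
    exact ⟨by rintro rfl; lia, fun hji => hwu.ne (hbelow j hji)⟩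

end IsNearlyCompressed

end NearlyCompressed

section InitialIdeal

open MvPolynomial

variable {σ R : Type*} [CommRing R] {m : MonomialOrder σ}

theorem monomial_mem_initialIdeal_of_sub_mem {I : Ideal (MvPolynomial σ R)} {s t : σ →₀ ℕ}
    (hst : monomial s 1 - monomial t 1 ∈ I) (hlt : t ≺[m] s) :
    monomial s 1 ∈ initialIdeal m I := by
  classical
  nontriviality R
  refine Ideal.subset_span ⟨_, hst, ?_⟩
  have hdeg : m.degree (monomial t (1 : R)) ≺[m] m.degree (monomial s (1 : R)) := by
    simpa [m.degree_monomial] using hlt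
  rw [MonomialOrder.leadingTerm, m.leadingCoeff_sub_of_lt hdeg, m.degree_sub_of_lt hdeg]
  simp [m.degree_monomial]

theorem monomial_mem_initialIdeal {I : Ideal (MvPolynomial σ R)} {s : σ →₀ ℕ}
    (hs : monomial s 1 ∈ I) : monomial s 1 ∈ initialIdeal m I :=
  Ideal.subset_span ⟨_, hs, m.leadingTerm_monomial _ _⟩

theorem isSquarefreeMonomialIdeal_initialIdeal {I : Ideal (MvPolynomial σ R)}
    (hI : ∀ f ∈ I, f ≠ 0 → ∃ s ≤ m.degree f, (∀ i, s i ≤ 1) ∧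
      monomial s 1 ∈ initialIdeal m I) : IsSquarefreeMonomialIdeal (initialIdeal m I) := by
  refine ⟨{s | (∀ i, s i ≤ 1) ∧ monomial s (1 : R) ∈ initialIdeal m I}, fun s hs => hs.1,
    le_antisymm (Ideal.span_le.2 ?_) (Ideal.span_le.2 ?_)⟩
  · rintro _ ⟨f, hf, rfl⟩
    rcases eq_or_ne f 0 with rfl | hf0
    · simp
    obtain ⟨s, hle, hs⟩ := hI f hf hf0
    have hmul : m.leadingTerm f =
        monomial (m.degree f - s) (m.leadingCoeff f) * monomial s 1 := by
      rw [monomial_mul, mul_one, tsub_add_cancel_of_le hle]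
      rfl
    rw [hmul]
    exact Ideal.mul_mem_left _ _ (Ideal.subset_span ⟨s, hs, rfl⟩)
  · rintro _ ⟨s, hs, rfl⟩
    exact hs.2

theorem IsRevLex.lt_of_forall_lt (hm : IsRevLex m) {s t : σ →₀ ℕ} (hdeg : t.degree = s.degree)
    {i : σ} (ht : t i ≠ 0) (hs : ∀ j, s j ≠ 0 → Finsupp.single i 1 ≺[m] Finsupp.single j 1) :
    t ≺[m] s := by
  classical
  have hsi : s i = 0 := by
    by_contra hsi
    exact lt_irrefl _ (hs i hsi)
  have hsupp : ∀ p, t p ≠ s p → p ∈ t.support ∪ s.support := fun p hp => by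
    rw [Finset.mem_union, Finsupp.mem_support_iff, Finsupp.mem_support_iff]
    lia
  obtain ⟨k, hk, hmin⟩ := ((t.support ∪ s.support).filter fun p => t p ≠ s p).exists_min_image
    (fun p => m.toSyn (Finsupp.single p 1))
    ⟨i, Finset.mem_filter.2 ⟨hsupp i (by lia), by lia⟩⟩
  have hsk : s k = 0 := by
    by_contra hsk
    exact (hs k hsk).not_ge (hmin i (Finset.mem_filter.2 ⟨hsupp i (by lia), by lia⟩))
  refine (hm t s).2 (.inr ⟨hdeg, k, ?_, fun j hj => ?_⟩)
  · have := (Finset.mem_filter.1 hk).2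
    lia
  · by_contra hne
    exact (hmin j (Finset.mem_filter.2 ⟨hsupp j hne, hne⟩)).not_gt hj

end InitialIdeal

section ToricIdeal

open MvPolynomial

variable {ι σ κ R : Type*} [CommRing R] {f : ι ↪ σ} {e : ι → κ →₀ ℕ}
  {φ : MvPolynomial σ R →ₐ[R] MvPolynomial κ R} {m : MonomialOrder σ}

theorem eq_mapDomain_or_exists (f : ι ↪ σ) (b : σ →₀ ℕ) :
    (∃ u : ι →₀ ℕ, u.mapDomain f = b) ∨ ∃ p ∉ Set.range f, b p ≠ 0 := by
  by_cases hb : (b.support : Set σ) ⊆ Set.range f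
  · exact .inl ⟨_, Finsupp.mapDomain_comapDomain f f.injective b hb⟩
  · obtain ⟨p, hp, hpf⟩ := Set.not_subset.1 hb
    exact .inr ⟨p, hpf, Finsupp.mem_support_iff.1 hp⟩

/-- The homomorphism `φ` maps the variable `x_(f i)` to the monomial with exponent `e i`, and
all variables that are not of this form to `0`. Up to these variables, its kernel is the toric
ideal of the configuration `e`. -/
structure IsMonomialMap (f : ι ↪ σ) (e : ι → κ →₀ ℕ)
    (φ : MvPolynomial σ R →ₐ[R] MvPolynomial κ R) : Prop where
  map_X : ∀ i, φ (X (f i)) = monomial (e i) 1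
  map_X_eq_zero : ∀ p ∉ Set.range f, φ (X p) = 0

namespace IsMonomialMap

theorem map_monomial_mapDomain (hφ : IsMonomialMap f e φ) (u : ι →₀ ℕ) (c : R) :
    φ (monomial (u.mapDomain f) c) = monomial (Finsupp.linearCombination ℕ e u) c := by
  rw [← mul_one c, ← smul_eq_mul c, ← smul_monomial, ← smul_monomial, map_smul]
  congr 1
  induction u using Finsupp.induction_linear with
  | zero => simp
  | add u v hu hv =>
    rw [Finsupp.mapDomain_add, map_add, ← mul_one (1 : R), ← monomial_mul, map_mul, hu, hv,
      monomial_mul]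
  | single i k =>
    rw [Finsupp.mapDomain_single, ← X_pow_eq_monomial, map_pow, hφ.map_X, monomial_pow,
      one_pow, Finsupp.linearCombination_single]

theorem map_monomial_eq_zero (hφ : IsMonomialMap f e φ) {b : σ →₀ ℕ} {p : σ}
    (hp : p ∉ Set.range f) (hb : b p ≠ 0) (c : R) : φ (monomial b c) = 0 := by
  have hle : Finsupp.single p 1 ≤ b := Finsupp.single_le_iff.2 (Nat.one_le_iff_ne_zero.2 hb)
  rw [← tsub_add_cancel_of_le hle, ← mul_one c, ← monomial_mul, map_mul]
  exact mul_eq_zero_of_right _ (hφ.map_X_eq_zero p hp)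

theorem exists_lt_of_mem_ker (hφ : IsMonomialMap f e φ) {F : MvPolynomial σ R} (hF : φ F = 0)
    (hF0 : F ≠ 0) {u : ι →₀ ℕ} (hu : u.mapDomain f = m.degree F) :
    ∃ w : ι →₀ ℕ, w.mapDomain f ≺[m] u.mapDomain f ∧
      Finsupp.linearCombination ℕ e w = Finsupp.linearCombination ℕ e u := by
  classical
  by_contra! hcon
  have hcoeff : coeff (Finsupp.linearCombination ℕ e u) (φ F) = m.leadingCoeff F := by
    conv_lhs => rw [F.as_sum, map_sum, coeff_sum]
    rw [Finset.sum_eq_single (m.degree F)]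
    · rw [← hu, hφ.map_monomial_mapDomain, coeff_monomial, if_pos rfl, hu]
      rfl
    · intro b hb hne
      obtain ⟨w, rfl⟩ | ⟨p, hp, hbp⟩ := eq_mapDomain_or_exists f b
      · rw [hφ.map_monomial_mapDomain, coeff_monomial, if_neg]
        refine hcon w (lt_of_le_of_ne (hu ▸ m.le_degree hb) fun h => hne ?_)
        rw [← hu]
        exact m.toSyn.injective h
      · rw [hφ.map_monomial_eq_zero hp hbp, coeff_zero]
    · exact fun h => absurd (m.degree_mem_support hF0) h
  rw [hF, coeff_zero, eq_comm, m.leadingCoeff_eq_zero_iff] at hcoeff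
  exact hF0 hcoeff

end IsMonomialMap

theorem degree_eq_map_linearCombination {V : Type*} [AddCommGroup V] {a : ι → V} {d : V →+ ℤ}
    (hd : ∀ i, d (a i) = 1) (u : ι →₀ ℕ) :
    (u.degree : ℤ) = d (Finsupp.linearCombination ℕ a u) := by
  rw [Finsupp.linearCombination_apply, Finsupp.sum, map_sum, Finsupp.degree_apply, Nat.cast_sum]
  exact Finset.sum_congr rfl fun i _ => by simp [hd]

theorem linearCombination_intCast (u : ι →₀ ℕ) :
    Finsupp.linearCombination ℕ (fun i x => (e i x : ℤ)) u =
      fun x => (Finsupp.linearCombination ℕ e u x : ℤ) := by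
  ext x
  simp [Finsupp.linearCombination_apply, Finsupp.sum, Finset.sum_apply, Finsupp.finsetSum_apply]

theorem degree_mapDomain_eq {d : (κ → ℤ) →+ ℤ} (hd : ∀ i, d (fun x => (e i x : ℤ)) = 1)
    {u w : ι →₀ ℕ} (h : Finsupp.linearCombination ℕ e u = Finsupp.linearCombination ℕ e w) :
    (u.mapDomain f).degree = (w.mapDomain f).degree := by
  rw [Finsupp.degree_mapDomain, Finsupp.degree_mapDomain, ← Nat.cast_inj (R := ℤ),
    degree_eq_map_linearCombination hd, degree_eq_map_linearCombination hd,
    linearCombination_intCast, linearCombination_intCast, h]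

namespace IsNearlyCompressed

variable {γ : Type*} {d : (κ → ℤ) →+ ℤ} {g : γ → (κ → ℤ) →+ ℤ} {D : Set ι}

theorem exists_squarefree_lt (ha : IsNearlyCompressed (fun i x => (e i x : ℤ)) g D)
    (hd : ∀ i, d (fun x => (e i x : ℤ)) = 1) (hm : IsRevLex m)
    (hD : ∀ i ∉ D, ∀ j ∈ D, Finsupp.single (f i) 1 ≺[m] Finsupp.single (f j) 1) {u w : ι →₀ ℕ}
    (huw : Finsupp.linearCombination ℕ e u = Finsupp.linearCombination ℕ e w)
    (hlt : w.mapDomain f ≺[m] u.mapDomain f) :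
    ∃ s t : ι →₀ ℕ, s ≤ u ∧ (∀ i, s i ≤ 1) ∧
      Finsupp.linearCombination ℕ e s = Finsupp.linearCombination ℕ e t ∧
        t.mapDomain f ≺[m] s.mapDomain f := by
  obtain ⟨p, hp, hbelow⟩ := ((hm _ _).1 hlt).elim
    (fun h => absurd (degree_mapDomain_eq hd huw) h.ne') And.right
  obtain ⟨i, rfl⟩ : p ∈ Set.range f := by
    by_contra hpf
    simp [Finsupp.mapDomain_of_notMem_range _ _ hpf] at hp
  simp only [Finsupp.mapDomain_apply f.injective] at hp
  obtain ⟨s, t, hsu, hs, hst, ht, hlow⟩ := ha.exists_squarefree_of_linearCombination_eq hD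
    (by rw [linearCombination_intCast, linearCombination_intCast, huw]) hp fun j hj => by
      simpa only [Finsupp.mapDomain_apply f.injective] using hbelow (f j) hj
  have hst' : Finsupp.linearCombination ℕ e s = Finsupp.linearCombination ℕ e t := by
    ext x
    simpa [linearCombination_intCast] using congrFun hst x
  refine ⟨s, t, hsu, hs, hst', hm.lt_of_forall_lt (i := f i) (degree_mapDomain_eq hd hst'.symm)
    (by rwa [Finsupp.mapDomain_apply f.injective]) fun q hq => ?_⟩
  obtain ⟨j, rfl⟩ : q ∈ Set.range f := by
    by_contra hqf
    exact hq (Finsupp.mapDomain_of_notMem_range _ _ hqf)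
  rw [Finsupp.mapDomain_apply f.injective] at hq
  obtain ⟨hne, hnlt⟩ := hlow j hq
  refine (not_lt.1 hnlt).lt_of_ne fun h => hne (f.injective ?_)
  exact (Finsupp.single_left_injective one_ne_zero (m.toSyn.injective h)).symm

theorem isSquarefreeMonomialIdeal_initialIdeal
    (ha : IsNearlyCompressed (fun i x => (e i x : ℤ)) g D)
    (hd : ∀ i, d (fun x => (e i x : ℤ)) = 1) (hφ : IsMonomialMap f e φ) (hm : IsRevLex m)
    (hD : ∀ i ∉ D, ∀ j ∈ D, Finsupp.single (f i) 1 ≺[m] Finsupp.single (f j) 1) :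
    IsSquarefreeMonomialIdeal (initialIdeal m (RingHom.ker φ)) := by
  refine GaussianDAG.isSquarefreeMonomialIdeal_initialIdeal fun F hF hF0 => ?_
  obtain ⟨u, hu⟩ | ⟨p, hp, hFp⟩ := eq_mapDomain_or_exists f (m.degree F)
  · obtain ⟨w, hlt, hwu⟩ := hφ.exists_lt_of_mem_ker hF hF0 hu
    obtain ⟨s, t, hsu, hs, hst, hts⟩ := ha.exists_squarefree_lt hd hm hD hwu.symm hlt
    refine ⟨s.mapDomain f, hu ▸ Finsupp.mapDomain_mono hsu, fun q => ?_,
      monomial_mem_initialIdeal_of_sub_mem ?_ hts⟩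
    · by_cases hq : q ∈ Set.range f
      · obtain ⟨i, rfl⟩ := hq
        simpa only [Finsupp.mapDomain_apply f.injective] using hs i
      · simp [Finsupp.mapDomain_of_notMem_range _ _ hq]
    · rw [RingHom.mem_ker, map_sub, hφ.map_monomial_mapDomain, hφ.map_monomial_mapDomain, hst,
        sub_self]
  · refine ⟨Finsupp.single p 1, Finsupp.single_le_iff.2 (Nat.one_le_iff_ne_zero.2 hFp),
      fun i => ?_, monomial_mem_initialIdeal (hφ.map_X_eq_zero p hp)⟩
    classical
    rw [Finsupp.single_apply]
    split_ifs <;> simp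

end IsNearlyCompressed

end ToricIdeal

variable {n : ℕ} {G : DAG n} {i j k v w : Fin n} {e f : G.Edge}

section Flows

open scoped Classical in
/-- The total weight of the edges into the vertex `v`, as a functional on parameter vectors. -/
noncomputable def DAG.inflow (G : DAG n) (v : Fin n) : (G.Param → ℤ) →+ ℤ :=
  ∑ e : G.Edge with e.1.2 = v, Pi.evalAddMonoidHom (fun _ => ℤ) (Sum.inr e)

open scoped Classical in
/-- The total weight of the edges out of the vertex `v`, as a functional on parameter
vectors. -/
noncomputable def DAG.outflow (G : DAG n) (v : Fin n) : (G.Param → ℤ) →+ ℤ :=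
  ∑ e : G.Edge with e.1.1 = v, Pi.evalAddMonoidHom (fun _ => ℤ) (Sum.inr e)

/-- The functional whose value at a sum of exponent vectors of treks is the number of these
treks that pass through `v`: such a trek has `v` as its top or enters `v` along an edge. -/
noncomputable def DAG.visits (G : DAG n) (v : Fin n) : (G.Param → ℤ) →+ ℤ :=
  Pi.evalAddMonoidHom (fun _ => ℤ) (Sum.inl v) + G.inflow v

/-- The functional whose value at a sum of exponent vectors of treks is the number of their
ends at `v`, where the empty trek at `v` has two ends. -/
noncomputable def DAG.ends (G : DAG n) (v : Fin n) : (G.Param → ℤ) →+ ℤ :=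
  2 • G.visits v - G.inflow v - G.outflow v

/-- The functional whose value at a sum of exponent vectors of treks is the number of these
treks that pass through the tail of `e` without using `e`. -/
noncomputable def DAG.avoids (G : DAG n) (e : G.Edge) : (G.Param → ℤ) →+ ℤ :=
  G.visits e.1.1 - Pi.evalAddMonoidHom (fun _ => ℤ) (Sum.inr e)

/-- The functional whose value at a sum of exponent vectors of treks is the number of these
treks. -/
noncomputable def DAG.total (G : DAG n) : (G.Param → ℤ) →+ ℤ :=
  ∑ v, Pi.evalAddMonoidHom (fun _ => ℤ) (Sum.inl v)

open scoped Classical in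
theorem DAG.inflow_apply (v : Fin n) (z : G.Param → ℤ) :
    G.inflow v z = ∑ e : G.Edge with e.1.2 = v, z (Sum.inr e) := by
  simp [DAG.inflow]

open scoped Classical in
theorem DAG.outflow_apply (v : Fin n) (z : G.Param → ℤ) :
    G.outflow v z = ∑ e : G.Edge with e.1.1 = v, z (Sum.inr e) := by
  simp [DAG.outflow]

theorem DAG.visits_apply (v : Fin n) (z : G.Param → ℤ) :
    G.visits v z = z (Sum.inl v) + G.inflow v z := rfl

theorem DAG.ends_apply (v : Fin n) (z : G.Param → ℤ) :
    G.ends v z = 2 * G.visits v z - G.inflow v z - G.outflow v z := by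
  simp [DAG.ends]

theorem DAG.avoids_apply (e : G.Edge) (z : G.Param → ℤ) :
    G.avoids e z = G.visits e.1.1 z - z (Sum.inr e) := rfl

theorem DAG.total_apply (z : G.Param → ℤ) : G.total z = ∑ v, z (Sum.inl v) := by
  simp [DAG.total]

theorem DAG.ext_visits {x y : G.Param → ℤ} (hvisits : ∀ v, G.visits v x = G.visits v y)
    (hedge : ∀ e, x (Sum.inr e) = y (Sum.inr e)) : x = y := by
  ext (v | e)
  · simpa [DAG.visits_apply, DAG.inflow_apply, hedge] using hvisits v
  · exact hedge e

theorem DAG.le_inflow {z : G.Param → ℤ} (hz : ∀ e, 0 ≤ z (Sum.inr e)) (e : G.Edge) :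
    z (Sum.inr e) ≤ G.inflow e.1.2 z := by
  rw [DAG.inflow_apply]
  exact Finset.single_le_sum (f := fun e => z (Sum.inr e)) (fun e _ => hz e) (by simp)

theorem DAG.le_outflow {z : G.Param → ℤ} (hz : ∀ e, 0 ≤ z (Sum.inr e)) (e : G.Edge) :
    z (Sum.inr e) ≤ G.outflow e.1.1 z := by
  rw [DAG.outflow_apply]
  exact Finset.single_le_sum (f := fun e => z (Sum.inr e)) (fun e _ => hz e) (by simp)

theorem inflow_single_inl : G.inflow v (Pi.single (Sum.inl i) 1) = 0 := by
  simp [DAG.inflow_apply]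

theorem outflow_single_inl : G.outflow v (Pi.single (Sum.inl i) 1) = 0 := by
  simp [DAG.outflow_apply]

theorem visits_single_inl :
    G.visits v (Pi.single (Sum.inl i) 1) = if i = v then 1 else 0 := by
  simp [DAG.visits_apply, inflow_single_inl, Pi.single_apply, eq_comm]

theorem ends_single_inl : G.ends v (Pi.single (Sum.inl i) 1) = if i = v then 2 else 0 := by
  simp [DAG.ends_apply, inflow_single_inl, outflow_single_inl, visits_single_inl]

theorem total_single_inl : G.total (Pi.single (Sum.inl i) 1) = 1 := by
  simp [DAG.total_apply, Pi.single_apply]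

theorem inflow_single_inr :
    G.inflow v (Pi.single (Sum.inr e) 1) = if e.1.2 = v then 1 else 0 := by
  simp [DAG.inflow_apply, Pi.single_apply]

theorem outflow_single_inr :
    G.outflow v (Pi.single (Sum.inr e) 1) = if e.1.1 = v then 1 else 0 := by
  simp [DAG.outflow_apply, Pi.single_apply]

theorem visits_single_inr :
    G.visits v (Pi.single (Sum.inr e) 1) = if e.1.2 = v then 1 else 0 := by
  simp [DAG.visits_apply, inflow_single_inr]

theorem ends_single_inr : G.ends v (Pi.single (Sum.inr e) 1) =
    (if e.1.2 = v then 1 else 0) - if e.1.1 = v then 1 else 0 := by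
  rw [DAG.ends_apply, visits_single_inr, inflow_single_inr, outflow_single_inr]
  ring

theorem avoids_single_inr : G.avoids f (Pi.single (Sum.inr e) 1) =
    (if e.1.2 = f.1.1 then 1 else 0) - if f = e then 1 else 0 := by
  simp [DAG.avoids_apply, visits_single_inr, Pi.single_apply]

theorem total_single_inr : G.total (Pi.single (Sum.inr e) 1) = 0 := by
  simp [DAG.total_apply]

end Flows

section WalkVectors

theorem DAG.Edge.skeleton_adj (e : G.Edge) : G.skeleton.Adj e.1.1 e.1.2 :=
  ⟨(G.lt_of_adj _ _ e.2).ne, Or.inl e.2⟩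

theorem DAG.Edge.mk_eq_mk_iff : s(e.1.1, e.1.2) = s(f.1.1, f.1.2) ↔ e = f := by
  refine ⟨fun h => ?_, fun h => by rw [h]⟩
  have he := G.lt_of_adj _ _ e.2
  have hf := G.lt_of_adj _ _ f.2
  rcases Sym2.eq_iff.1 h with ⟨h1, h2⟩ | ⟨h1, h2⟩
  · exact Subtype.ext (Prod.ext h1 h2)
  · rw [h1, h2] at he
    exact absurd he hf.asymm

theorem DAG.exists_edge_of_skeleton_adj (h : G.skeleton.Adj i j) :
    ∃ e : G.Edge, s(e.1.1, e.1.2) = s(i, j) := by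
  rcases h.2 with h | h
  · exact ⟨⟨(i, j), h⟩, rfl⟩
  · exact ⟨⟨(j, i), h⟩, Sym2.eq_swap⟩

open scoped Classical in
/-- The vector of a walk in the space of exponent vectors: its coordinate at an edge is the
number of times that the walk traverses the edge, and its coordinates at the vertices are
chosen such that `DAG.visits` counts the visits of the walk. It agrees with the exponent vector
if the walk is a trek. -/
noncomputable def walkVector (p : G.skeleton.Walk i j) : G.Param → ℤ :=
  Sum.elim
    (fun v => p.support.count v -
      ∑ e : G.Edge with e.1.2 = v, (p.edges.count s(e.1.1, e.1.2) : ℤ))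
    (fun e => p.edges.count s(e.1.1, e.1.2))

theorem walkVector_inr (p : G.skeleton.Walk i j) (e : G.Edge) :
    walkVector p (Sum.inr e) = p.edges.count s(e.1.1, e.1.2) := rfl

theorem walkVector_inr_nonneg (p : G.skeleton.Walk i j) (e : G.Edge) :
    0 ≤ walkVector p (Sum.inr e) :=
  Nat.cast_nonneg _

theorem visits_walkVector (p : G.skeleton.Walk i j) (v : Fin n) :
    G.visits v (walkVector p) = p.support.count v := by
  simp [DAG.visits_apply, DAG.inflow_apply, walkVector]

theorem walkVector_nil (v : Fin n) :
    walkVector (.nil : G.skeleton.Walk v v) = Pi.single (Sum.inl v) 1 := by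
  refine DAG.ext_visits (fun w => ?_) fun e => ?_
  · simp [visits_walkVector, visits_single_inl, List.count_singleton]
  · simp [walkVector_inr]

theorem walkVector_cons (h : G.skeleton.Adj i j) (p : G.skeleton.Walk j k)
    (he : s(e.1.1, e.1.2) = s(i, j)) :
    walkVector (.cons h p) = walkVector p + Pi.single (Sum.inr e) 1 + Pi.single (Sum.inl i) 1 -
      Pi.single (Sum.inl e.1.2) 1 := by
  refine DAG.ext_visits (fun v => ?_) fun f => ?_
  · simp only [map_add, map_sub, visits_walkVector, visits_single_inl, visits_single_inr,
      SimpleGraph.Walk.support_cons, List.count_cons, beq_iff_eq]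
    push_cast
    ring
  · simp only [Pi.add_apply, Pi.sub_apply, walkVector_inr, SimpleGraph.Walk.edges_cons,
      List.count_cons, ← he, beq_iff_eq, DAG.Edge.mk_eq_mk_iff, Pi.single_apply, Sum.inr.injEq,
      reduceCtorEq, if_false, eq_comm (a := f)]
    push_cast
    ring

theorem walkVector_cons_of_head (e : G.Edge) (p : G.skeleton.Walk e.1.1 j) :
    walkVector (.cons e.skeleton_adj.symm p) = walkVector p + Pi.single (Sum.inr e) 1 := by
  rw [walkVector_cons _ _ Sym2.eq_swap, add_sub_cancel_right]

theorem walkVector_append (r : G.skeleton.Walk i v) (p : G.skeleton.Walk v j) :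
    walkVector (r.append p) + Pi.single (Sum.inl v) 1 = walkVector r + walkVector p := by
  induction r with
  | nil => rw [SimpleGraph.Walk.nil_append, walkVector_nil, add_comm]
  | cons h r ih =>
    obtain ⟨e, he⟩ := DAG.exists_edge_of_skeleton_adj h
    rw [SimpleGraph.Walk.cons_append, walkVector_cons h _ he, walkVector_cons h _ he,
      eq_sub_of_add_eq (ih p)]
    abel

theorem walkVector_reverse (p : G.skeleton.Walk i j) : walkVector p.reverse = walkVector p := by
  refine DAG.ext_visits (fun v => ?_) fun e => ?_
  · simp [visits_walkVector]
  · simp [walkVector_inr]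

theorem ends_walkVector (p : G.skeleton.Walk i j) (v : Fin n) :
    G.ends v (walkVector p) = (if i = v then 1 else 0) + if j = v then 1 else 0 := by
  induction p with
  | nil =>
    rw [walkVector_nil, ends_single_inl]
    split_ifs <;> rfl
  | @cons i j k h p ih =>
    obtain ⟨e, he⟩ := DAG.exists_edge_of_skeleton_adj h
    rw [walkVector_cons h p he, map_sub, map_add, map_add, ih, ends_single_inl, ends_single_inl,
      ends_single_inr]
    rcases Sym2.eq_iff.1 he with ⟨rfl, rfl⟩ | ⟨rfl, rfl⟩ <;> split_ifs <;> lia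

theorem total_walkVector (p : G.skeleton.Walk i j) : G.total (walkVector p) = 1 := by
  induction p with
  | nil => rw [walkVector_nil, total_single_inl]
  | cons h p ih =>
    obtain ⟨e, he⟩ := DAG.exists_edge_of_skeleton_adj h
    rw [walkVector_cons h p he, map_sub, map_add, map_add, ih, total_single_inl,
      total_single_inl, total_single_inr]
    rfl

open scoped Classical in
theorem inflow_walkVector {p : G.skeleton.Walk i j} (hp : p.IsTrail) (v : Fin n) :
    G.inflow v (walkVector p) = Finset.card {e : G.Edge | e.1.2 = v ∧ G.Uses p e.1.1 e.1.2} := by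
  have hcount : ∀ e : G.Edge, walkVector p (Sum.inr e) =
      if G.Uses p e.1.1 e.1.2 then 1 else 0 := fun e => by
    rw [walkVector_inr]
    split_ifs with he
    · rw [hp.count_edges_eq_one he.2, Nat.cast_one]
    · rw [List.count_eq_zero_of_not_mem fun h => he ⟨e.2, h⟩, Nat.cast_zero]
  simp only [DAG.inflow_apply, hcount, Finset.sum_boole, Finset.filter_filter]

end WalkVectors

section Treks

/-- A walk is a trek if it is a path without colliders. -/
def IsTrek (p : G.skeleton.Walk i j) : Prop :=
  p.IsPath ∧ ∀ u w k : Fin n, G.Uses p u k → G.Uses p w k → u = w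

namespace IsTrek

variable {p : G.skeleton.Walk i j}

/-- A collider-free path as an element of `T(i, j)`. -/
def toTrek (hp : IsTrek p) : G.Trek i j := ⟨⟨p, hp.1⟩, hp.2⟩

protected theorem nil : IsTrek (.nil : G.skeleton.Walk i i) :=
  ⟨.nil, fun u w k h => by simp [DAG.Uses] at h⟩

theorem of_edges_subset {q : G.skeleton.Walk v w} (hq : IsTrek q) (hp : p.IsPath)
    (h : p.edges ⊆ q.edges) : IsTrek p :=
  ⟨hp, fun u w k hu hw => hq.2 u w k ⟨hu.1, h hu.2⟩ ⟨hw.1, h hw.2⟩⟩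

protected theorem reverse (hp : IsTrek p) : IsTrek p.reverse :=
  hp.of_edges_subset hp.1.reverse (by simp)

end IsTrek

theorem DAG.Trek.isTrek (P : G.Trek i j) : IsTrek P.walk := ⟨P.1.2, P.2⟩

theorem isTrek_iff_walkVector_inl_nonneg {p : G.skeleton.Walk i j} :
    IsTrek p ↔ p.IsPath ∧ ∀ v, 0 ≤ walkVector p (Sum.inl v) := by
  classical
  refine and_congr_right fun hp => ?_
  have hinl : ∀ v, walkVector p (Sum.inl v) = p.support.count v -
      (Finset.card {e : G.Edge | e.1.2 = v ∧ G.Uses p e.1.1 e.1.2} : ℤ) := fun v => by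
    rw [← inflow_walkVector hp.isTrail, ← visits_walkVector, DAG.visits_apply,
      add_sub_cancel_right]
  simp only [hinl, sub_nonneg, Nat.cast_le]
  constructor
  · intro hcoll v
    rcases Finset.eq_empty_or_nonempty {e : G.Edge | e.1.2 = v ∧ G.Uses p e.1.1 e.1.2} with h | h
    · simp [h]
    obtain ⟨e, hmem⟩ := h
    obtain ⟨rfl, he⟩ := (Finset.mem_filter.1 hmem).2
    rw [List.count_eq_one_of_mem hp.support_nodup (p.snd_mem_support_of_mem_edges he.2),
      Finset.card_le_one]
    simp only [Finset.mem_filter_univ]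
    rintro ⟨⟨u, _⟩, hu⟩ ⟨rfl, huse⟩ ⟨⟨w, _⟩, hw⟩ ⟨rfl, hwse⟩
    exact Subtype.ext (Prod.ext (hcoll _ _ _ huse hwse) rfl)
  · intro hcard u w k hu hw
    have hle := (hcard k).trans (List.nodup_iff_count_le_one.1 hp.support_nodup k)
    exact congrArg (fun e : G.Edge => e.1.1)
      (Finset.card_le_one.1 hle ⟨(u, k), hu.1⟩ (by simpa using hu)
        ⟨(w, k), hw.1⟩ (by simpa using hw))

theorem isPath_append_of_isAcyclic {V : Type*} {H : SimpleGraph V} (hH : H.IsAcyclic)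
    {i j v k : V} {r : H.Walk i v} {p : H.Walk v j} (hr : r.IsPath) (hp : p.IsPath)
    (hkp : s(v, k) ∈ p.edges) (hkr : s(v, k) ∉ r.edges) : (r.append p).IsPath := by
  rw [hH.isPath_iff_isChain] at hr ⊢
  rw [SimpleGraph.Walk.edges_append, List.isChain_append]
  refine ⟨hr, (hH.isPath_iff_isChain _).1 hp, fun x hx y hy => ?_⟩
  have hhead : p.edges.head? = some s(v, k) := by
    rw [List.head?_eq_some_head (List.ne_nil_of_mem hkp), p.head_edges_eq_mk_start_snd,
      hp.eq_snd_of_mem_edges hkp]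
  rw [hhead, Option.mem_some_iff] at hy
  exact ne_of_mem_of_not_mem (List.mem_of_getLast? hx) (hy ▸ hkr)

namespace IsTrek

variable {p : G.skeleton.Walk i j}

theorem walkVector_inl_nonneg (hp : IsTrek p) (v : Fin n) : 0 ≤ walkVector p (Sum.inl v) :=
  (isTrek_iff_walkVector_inl_nonneg.1 hp).2 v

theorem one_le_walkVector_inl {p : G.skeleton.Walk e.1.1 j} (hp : IsTrek p)
    (he : s(e.1.1, e.1.2) ∈ p.edges) : 1 ≤ walkVector p (Sum.inl e.1.1) := by
  have hvisits := visits_walkVector p e.1.1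
  rw [List.count_eq_one_of_mem hp.1.support_nodup p.start_mem_support, Nat.cast_one] at hvisits
  have hends := ends_walkVector p e.1.1
  rw [DAG.ends_apply, hvisits, if_pos rfl] at hends
  have hedge : 1 ≤ walkVector p (Sum.inr e) := by
    rw [walkVector_inr, hp.1.isTrail.count_edges_eq_one he, Nat.cast_one]
  have houtflow := DAG.le_outflow (walkVector_inr_nonneg p) e
  rw [DAG.visits_apply] at hvisits
  split_ifs at hends <;> lia

protected theorem cons (hG : G.skeleton.IsAcyclic) {p : G.skeleton.Walk e.1.1 j} (hp : IsTrek p)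
    (he : s(e.1.1, e.1.2) ∉ p.edges) : IsTrek (.cons e.skeleton_adj.symm p) := by
  refine isTrek_iff_walkVector_inl_nonneg.2 ⟨?_, fun v => ?_⟩
  · rw [hG.isPath_iff_isTrail, SimpleGraph.Walk.isTrail_cons, Sym2.eq_swap]
    exact ⟨hp.1.isTrail, he⟩
  · simpa [walkVector_cons_of_head] using hp.walkVector_inl_nonneg v

protected theorem append (hG : G.skeleton.IsAcyclic) {r : G.skeleton.Walk i e.1.1}
    {p : G.skeleton.Walk e.1.1 j} (hr : IsTrek r) (hp : IsTrek p)
    (hep : s(e.1.1, e.1.2) ∈ p.edges) (her : s(e.1.1, e.1.2) ∉ r.edges) :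
    IsTrek (r.append p) := by
  refine isTrek_iff_walkVector_inl_nonneg.2
    ⟨isPath_append_of_isAcyclic hG hr.1 hp.1 hep her, fun v => ?_⟩
  have happend := congrFun (walkVector_append r p) (Sum.inl v)
  rw [Pi.add_apply, Pi.add_apply, Pi.single_apply] at happend
  have hrv := hr.walkVector_inl_nonneg v
  split_ifs at happend with hv
  · have hpv := hp.one_le_walkVector_inl hep
    rw [hv] at happend hrv ⊢
    lia
  · have hpv := hp.walkVector_inl_nonneg v
    lia

end IsTrek

theorem DAG.Trek.exponent_eq (P : G.Trek i j) (x : G.Param) :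
    (P.exponent x : ℤ) = walkVector P.walk x := by
  classical
  have htrail := P.isTrek.1.isTrail
  rcases x with v | e
  · obtain ⟨htop, huse⟩ : P.top ∈ P.walk.support ∧ ∀ k, ¬ G.Uses P.walk k P.top :=
      P.exists_top.choose_spec
    have hone : walkVector P.walk (Sum.inl P.top) = 1 := by
      have hvisits := visits_walkVector P.walk P.top
      rw [DAG.visits_apply, inflow_walkVector htrail,
        List.count_eq_one_of_mem P.isTrek.1.support_nodup htop, Finset.card_eq_zero.2 <|
          Finset.filter_eq_empty_iff.2 fun e _ he => huse e.1.1 (he.1 ▸ he.2)] at hvisits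
      simpa using hvisits
    have hzero : ∀ v ≠ P.top, walkVector P.walk (Sum.inl v) = 0 := fun v hv => by
      have htotal := total_walkVector P.walk
      rw [DAG.total_apply, ← Finset.add_sum_erase _ _ (Finset.mem_univ P.top), hone,
        add_eq_left, Finset.sum_eq_zero_iff_of_nonneg fun v _ =>
          P.isTrek.walkVector_inl_nonneg v] at htotal
      exact htotal v (by simp [hv])
    rcases eq_or_ne v P.top with rfl | hv
    · simp [DAG.Trek.exponent, hone]
    · simp [DAG.Trek.exponent, hzero v hv, hv]
  · rw [walkVector_inr]
    by_cases he : G.Uses P.walk e.1.1 e.1.2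
    · simp [DAG.Trek.exponent, he, htrail.count_edges_eq_one he.2]
    · have hnot : s(e.1.1, e.1.2) ∉ P.walk.edges := fun h => he ⟨e.2, h⟩
      simp [DAG.Trek.exponent, he, List.count_eq_zero_of_not_mem hnot]

end Treks

section Decomposition

theorem exists_mem_sub_mem_closure {V M : Type*} [AddCommGroup V] [AddMonoid M] [LinearOrder M]
    [AddLeftMono M] {S : Set V} {h : V →+ M} {z : V}
    (hz : z ∈ AddSubmonoid.closure S) (hpos : 0 < h z) :
    ∃ x ∈ S, 0 < h x ∧ z - x ∈ AddSubmonoid.closure S := by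
  induction hz using AddSubmonoid.closure_induction with
  | mem x hx => exact ⟨x, hx, hpos, by simp⟩
  | zero => simp at hpos
  | add x y hx hy ihx ihy =>
    rw [map_add] at hpos
    by_cases hxpos : 0 < h x
    · obtain ⟨s, hs, hspos, hmem⟩ := ihx hxpos
      exact ⟨s, hs, hspos, by simpa [add_sub_right_comm] using add_mem hmem hy⟩
    · obtain ⟨s, hs, hspos, hmem⟩ := ihy <| by
        by_contra hypos
        exact hpos.not_ge (add_nonpos (not_lt.1 hxpos) (not_lt.1 hypos))
      exact ⟨s, hs, hspos, by simpa [add_sub_assoc] using add_mem hx hmem⟩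

/-- The set of the vectors of all treks in `G`. -/
def trekVectors (G : DAG n) : Set (G.Param → ℤ) :=
  {z | ∃ (i j : Fin n) (p : G.skeleton.Walk i j), IsTrek p ∧ walkVector p = z}

theorem IsTrek.walkVector_mem_closure {p : G.skeleton.Walk i j} (hp : IsTrek p) :
    walkVector p ∈ AddSubmonoid.closure (trekVectors G) :=
  AddSubmonoid.subset_closure ⟨i, j, p, hp, rfl⟩

theorem exists_walk_of_ends_pos {x : G.Param → ℤ} (hx : x ∈ trekVectors G) (hv : 0 < G.ends v x) :
    ∃ (j : Fin n) (p : G.skeleton.Walk v j), IsTrek p ∧ walkVector p = x := by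
  obtain ⟨i, j, p, hp, rfl⟩ := hx
  rw [ends_walkVector] at hv
  rcases eq_or_ne i v with rfl | hi
  · exact ⟨j, p, hp, rfl⟩
  rcases eq_or_ne j v with rfl | hj
  · exact ⟨i, p.reverse, hp.reverse, walkVector_reverse p⟩
  simp [hi, hj] at hv

theorem IsTrek.avoids_walkVector {p : G.skeleton.Walk i j} (hp : IsTrek p) (e : G.Edge) :
    G.avoids e (walkVector p) =
      if e.1.1 ∈ p.support ∧ s(e.1.1, e.1.2) ∉ p.edges then 1 else 0 := by
  rw [DAG.avoids_apply, visits_walkVector, walkVector_inr]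
  by_cases he : s(e.1.1, e.1.2) ∈ p.edges
  · rw [hp.1.isTrail.count_edges_eq_one he,
      List.count_eq_one_of_mem hp.1.support_nodup (p.fst_mem_support_of_mem_edges he)]
    simp [he]
  rw [List.count_eq_zero_of_not_mem he]
  by_cases hv : e.1.1 ∈ p.support
  · simp [List.count_eq_one_of_mem hp.1.support_nodup hv, hv, he]
  · simp [List.count_eq_zero_of_not_mem hv, hv]

/-- The two treks exchange their ends at the tail `v` of `e`: `p` continues the part of `q`
before `v`, and the part of `q` after `v` is prolonged by `e`. -/
theorem IsTrek.exchange (hG : G.skeleton.IsAcyclic) {p : G.skeleton.Walk e.1.1 k}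
    {q : G.skeleton.Walk i j} (hp : IsTrek p) (hq : IsTrek q)
    (hep : s(e.1.1, e.1.2) ∈ p.edges) (heq : s(e.1.1, e.1.2) ∉ q.edges)
    (hv : e.1.1 ∈ q.support) :
    walkVector p + walkVector q + Pi.single (Sum.inr e) 1 ∈
      AddSubmonoid.closure (trekVectors G) := by
  have hbefore : IsTrek ((q.takeUntil _ hv).append p) :=
    .append hG (hq.of_edges_subset (hq.1.takeUntil hv) (q.edges_takeUntil_subset_edges hv)) hp hep
      fun h => heq (q.edges_takeUntil_subset_edges hv h)
  have hafter : IsTrek (.cons e.skeleton_adj.symm (q.dropUntil _ hv)) :=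
    .cons hG (hq.of_edges_subset (hq.1.dropUntil hv) (q.edges_dropUntil_subset_edges hv))
      fun h => heq (q.edges_dropUntil_subset_edges hv h)
  have hsplit := walkVector_append (q.takeUntil _ hv) (q.dropUntil _ hv)
  rw [q.take_spec hv] at hsplit
  convert add_mem hbefore.walkVector_mem_closure hafter.walkVector_mem_closure using 1
  rw [walkVector_cons_of_head, eq_sub_of_add_eq (walkVector_append _ p), eq_sub_of_add_eq hsplit]
  abel

theorem add_single_mem_closure_trekVectors (hG : G.skeleton.IsAcyclic) {z : G.Param → ℤ}
    (hz : z ∈ AddSubmonoid.closure (trekVectors G)) (hends : 0 < G.ends e.1.1 z)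
    (havoids : 0 < G.avoids e z) :
    z + Pi.single (Sum.inr e) 1 ∈ AddSubmonoid.closure (trekVectors G) := by
  obtain ⟨x, hx, hxpos, hzx⟩ := exists_mem_sub_mem_closure hz hends
  obtain ⟨b, p, hp, rfl⟩ := exists_walk_of_ends_pos hx hxpos
  by_cases hep : s(e.1.1, e.1.2) ∈ p.edges
  · have hpos : 0 < G.avoids e (z - walkVector p) := by
      simpa [hp.avoids_walkVector, hep] using havoids
    obtain ⟨_, ⟨i, j, q, hq, rfl⟩, hqpos, hzxy⟩ := exists_mem_sub_mem_closure hzx hpos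
    obtain ⟨hv, heq⟩ : e.1.1 ∈ q.support ∧ s(e.1.1, e.1.2) ∉ q.edges := by
      by_contra hcon
      simp [hq.avoids_walkVector, hcon] at hqpos
    convert add_mem hzxy (hp.exchange hG hq hep heq hv) using 1
    abel
  · convert add_mem hzx (hp.cons hG hep).walkVector_mem_closure using 1
    rw [walkVector_cons_of_head]
    abel

/-- The index set of the inequalities that describe the cone over the polytope of a tree. -/
inductive DAG.Ineq (G : DAG n) : Type
  | coord (x : G.Param)
  | ends (v : Fin n)
  | avoids (e : G.Edge)

/-- The functionals that are required to be nonnegative on the cone over the polytope of a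
tree. -/
noncomputable def DAG.Ineq.functional : G.Ineq → (G.Param → ℤ) →+ ℤ
  | .coord x => Pi.evalAddMonoidHom (fun _ => ℤ) x
  | .ends v => G.ends v
  | .avoids e => G.avoids e

theorem mem_closure_trekVectors_of_inr_eq_zero {z : G.Param → ℤ} (hz : ∀ v, 0 ≤ z (Sum.inl v))
    (hedge : ∀ e, z (Sum.inr e) = 0) : z ∈ AddSubmonoid.closure (trekVectors G) := by
  have hsum : z = ∑ v, (z (Sum.inl v)).toNat • Pi.single (Sum.inl v) 1 := by
    ext (v | e)
    · simp [Finset.sum_apply, Pi.single_apply, hz]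
    · simp [Finset.sum_apply, hedge]
  rw [hsum]
  exact sum_mem fun v _ => nsmul_mem (walkVector_nil v ▸ IsTrek.nil.walkVector_mem_closure) _

open scoped Classical in
theorem exists_edge_outflow_eq_zero {z : G.Param → ℤ} (hz : ∀ e, 0 ≤ z (Sum.inr e))
    (hpos : 0 < ∑ e, z (Sum.inr e)) : ∃ e, 0 < z (Sum.inr e) ∧ G.outflow e.1.2 z = 0 := by
  obtain ⟨e₀, -, he₀⟩ := (Finset.sum_pos_iff_of_nonneg fun e _ => hz e).1 hpos
  obtain ⟨e, he, hmax⟩ := Finset.exists_max_image {e : G.Edge | 0 < z (Sum.inr e)}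
    (fun e => e.1.2) ⟨e₀, by simpa using he₀⟩
  refine ⟨e, by simpa using he, ?_⟩
  rw [DAG.outflow_apply]
  refine Finset.sum_eq_zero fun f hf => le_antisymm (not_lt.1 fun hfpos => ?_) (hz f)
  have hfe : f.1.1 = e.1.2 := by simpa using hf
  exact (G.lt_of_adj _ _ f.2).not_ge (hfe ▸ hmax f (by simpa using hfpos))

theorem functional_sub_single_nonneg {z : G.Param → ℤ} (hz : ∀ c : G.Ineq, 0 ≤ c.functional z)
    (hpos : 0 < z (Sum.inr e)) (hout : G.outflow e.1.2 z = 0) (c : G.Ineq) :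
    0 ≤ c.functional (z - Pi.single (Sum.inr e) 1) := by
  have hedge : ∀ f, 0 ≤ z (Sum.inr f) := fun f => hz (.coord (.inr f))
  have hinl : 0 ≤ z (Sum.inl e.1.2) := hz (.coord (.inl e.1.2))
  have hinflow : 1 ≤ G.inflow e.1.2 z := hpos.trans_le (DAG.le_inflow hedge e)
  have hvisits := DAG.visits_apply e.1.2 z
  have hc := hz c
  rw [map_sub, sub_nonneg]
  rcases c with x | v | f
  · rcases eq_or_ne x (Sum.inr e) with rfl | hx
    · simpa [DAG.Ineq.functional] using Order.one_le_iff_pos.2 hpos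
    · simpa [DAG.Ineq.functional, hx] using hc
  · have hends := DAG.ends_apply e.1.2 z
    simp only [DAG.Ineq.functional, ends_single_inr] at hc ⊢
    split_ifs <;> subst_vars <;> lia
  · simp only [DAG.Ineq.functional, avoids_single_inr] at hc ⊢
    rcases eq_or_ne e.1.2 f.1.1 with hef | hef
    · have hfz : z (Sum.inr f) ≤ G.outflow f.1.1 z := DAG.le_outflow hedge f
      rw [DAG.avoids_apply, ← hef]
      rw [← hef] at hfz
      split_ifs <;> lia
    · rw [if_neg hef]
      split_ifs <;> lia

/-- Lower the weight of an edge into a lowest vertex by one, decompose the result by induction,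
and raise the weight again. -/
theorem mem_closure_trekVectors (hG : G.skeleton.IsAcyclic) {z : G.Param → ℤ}
    (hz : ∀ c : G.Ineq, 0 ≤ c.functional z) : z ∈ AddSubmonoid.closure (trekVectors G) := by
  classical
  obtain ⟨N, hN⟩ : ∃ N : ℕ, ∑ e, z (Sum.inr e) = N :=
    Int.eq_ofNat_of_zero_le (Finset.sum_nonneg fun e _ => hz (.coord (.inr e)))
  have hedge : ∀ e, 0 ≤ z (Sum.inr e) := fun e => hz (.coord (.inr e))
  induction N generalizing z with
  | zero =>
    refine mem_closure_trekVectors_of_inr_eq_zero (fun v => hz (.coord (.inl v))) fun e => ?_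
    exact (Finset.sum_eq_zero_iff_of_nonneg fun e _ => hedge e).1 hN e (Finset.mem_univ e)
  | succ N ih =>
    obtain ⟨e, hpos, hout⟩ := exists_edge_outflow_eq_zero hedge (hN ▸ by positivity)
    have hz' := functional_sub_single_nonneg hz hpos hout
    have hmem := ih hz' (by simp [Finset.sum_sub_distrib, hN, Pi.single_apply])
      fun f => hz' (.coord (.inr f))
    have hne : e.1.2 ≠ e.1.1 := (G.lt_of_adj _ _ e.2).ne'
    rw [← sub_add_cancel z (Pi.single (Sum.inr e) 1)]
    refine add_single_mem_closure_trekVectors hG hmem ?_ ?_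
    · have hends : 0 ≤ G.ends e.1.1 z := hz (.ends e.1.1)
      rw [map_sub, ends_single_inr, if_neg hne, if_pos rfl]
      lia
    · have havoids : 0 ≤ G.avoids e z := hz (.avoids e)
      rw [map_sub, avoids_single_inr, if_neg hne, if_pos rfl]
      lia

end Decomposition

section Configuration

theorem IsTrek.functional_nonneg {p : G.skeleton.Walk i j} (hp : IsTrek p) (c : G.Ineq) :
    0 ≤ c.functional (walkVector p) := by
  rcases c with (v | e) | v | e
  · exact hp.walkVector_inl_nonneg v
  · exact walkVector_inr_nonneg p e
  · rw [DAG.Ineq.functional, ends_walkVector]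
    positivity
  · rw [DAG.Ineq.functional, hp.avoids_walkVector]
    positivity

theorem IsTrek.functional_le_one {p : G.skeleton.Walk i j} (hp : IsTrek p) (hij : i ≠ j)
    (c : G.Ineq) : c.functional (walkVector p) ≤ 1 := by
  rcases c with (v | e) | v | e
  · rw [← total_walkVector p, DAG.total_apply]
    exact Finset.single_le_sum (f := fun v => walkVector p (Sum.inl v))
      (fun v _ => hp.walkVector_inl_nonneg v) (Finset.mem_univ v)
  · exact Nat.cast_le_one.2 (hp.1.isTrail.count_edges_le_one s(e.1.1, e.1.2))
  · rw [DAG.Ineq.functional, ends_walkVector]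
    split_ifs with hi hj
    · exact absurd (hi.trans hj.symm) hij
    all_goals simp
  · rw [DAG.Ineq.functional, hp.avoids_walkVector]
    split_ifs <;> simp

theorem subsingleton_trek (hG : G.skeleton.IsAcyclic) (i j : Fin n) : Subsingleton (G.Trek i j) :=
  ⟨fun P Q => Subtype.ext ((hG.subsingleton_path i j).elim P.1 Q.1)⟩

theorem config_apply (p : G.TrekPair) : G.config p = walkVector (Classical.choice p.2).walk :=
  funext (Classical.choice p.2).exponent_eq

theorem config_eq_walkVector (hG : G.skeleton.IsAcyclic) (p : G.TrekPair)
    {q : G.skeleton.Walk p.1.1.1 p.1.1.2} (hq : IsTrek q) : G.config p = walkVector q := by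
  rw [config_apply, (subsingleton_trek hG _ _).elim (Classical.choice p.2) hq.toTrek]
  rfl

theorem config_eq_single (hG : G.skeleton.IsAcyclic) {p : G.TrekPair}
    (hp : p.1.1.1 = p.1.1.2) : G.config p = Pi.single (Sum.inl p.1.1.1) 1 := by
  obtain ⟨⟨⟨i, j⟩, hij⟩, hne⟩ := p
  obtain rfl : i = j := hp
  exact (config_eq_walkVector hG ⟨⟨(i, i), hij⟩, hne⟩ IsTrek.nil).trans (walkVector_nil i)

theorem total_config (p : G.TrekPair) : G.total (G.config p) = 1 := by
  rw [config_apply, total_walkVector]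

theorem trekVectors_subset_range_config (hG : G.skeleton.IsAcyclic) :
    trekVectors G ⊆ Set.range G.config := by
  rintro _ ⟨i, j, p, hp, rfl⟩
  rcases le_total i j with h | h
  · exact ⟨_, config_eq_walkVector hG ⟨⟨(i, j), h⟩, ⟨hp.toTrek⟩⟩ hp⟩
  · exact ⟨_, (config_eq_walkVector hG ⟨⟨(j, i), h⟩, ⟨hp.reverse.toTrek⟩⟩ hp.reverse).trans
      (walkVector_reverse p)⟩

theorem isNearlyCompressed_config (hG : G.skeleton.IsAcyclic) :
    IsNearlyCompressed G.config (DAG.Ineq.functional (G := G)) {p | p.1.1.1 = p.1.1.2} where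
  nonneg c p := by
    rw [config_apply]
    exact (Classical.choice p.2).isTrek.functional_nonneg c
  generate z hz := AddSubmonoid.closure_mono (trekVectors_subset_range_config hG)
    (mem_closure_trekVectors hG hz)
  height_le p hp c := by
    rw [config_apply]
    exact (Classical.choice p.2).isTrek.functional_le_one hp c
  dual p hp := by
    refine ⟨.coord (Sum.inl p.1.1.1), ?_, fun q hq hqp => ?_⟩
    · simp [DAG.Ineq.functional, config_eq_single hG hp]
    · have hne : p.1.1.1 ≠ q.1.1.1 := fun h =>
        hqp (Subtype.ext (Subtype.ext (Prod.ext h.symm (hq.symm.trans (h.symm.trans hp)))))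
      simp [DAG.Ineq.functional, config_eq_single hG hq, hne]

theorem phi_X (hG : G.skeleton.IsAcyclic) (p : G.TrekPair) :
    G.phi (MvPolynomial.X p.1) =
      MvPolynomial.monomial (Finsupp.equivFunOnFinite.symm (Classical.choice p.2).exponent) 1 := by
  classical
  have := subsingleton_trek hG p.1.1.1 p.1.1.2
  rw [DAG.phi, MvPolynomial.aeval_X, Fintype.sum_subsingleton _ (Classical.choice p.2),
    DAG.Trek.monomial_eq, MvPolynomial.monomial_eq, Finsupp.prod_fintype _ _ (by simp)]
  simp

theorem phi_X_eq_zero {p : SigmaVar n} (hp : IsEmpty (G.Trek p.1.1 p.1.2)) :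
    G.phi (MvPolynomial.X p) = 0 := by
  rw [DAG.phi, MvPolynomial.aeval_X, Fintype.sum_empty]

theorem isMonomialMap_phi (hG : G.skeleton.IsAcyclic) :
    IsMonomialMap (Function.Embedding.subtype _)
      (fun p : G.TrekPair => Finsupp.equivFunOnFinite.symm (Classical.choice p.2).exponent)
      G.phi where
  map_X := phi_X hG
  map_X_eq_zero p hp := phi_X_eq_zero (by simpa using hp)

end Configuration

end GaussianDAG

open scoped Classical in
theorem mainTheorem9_general {n : ℕ} (T : GaussianDAG.DAG n) (hT : T.skeleton.IsAcyclic)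
    (m : MonomialOrder (GaussianDAG.SigmaVar n)) (hm : GaussianDAG.IsRevLex m)
    (hdiag : ∀ p q : GaussianDAG.SigmaVar n, p.1.1 = p.1.2 → q.1.1 ≠ q.1.2 →
      Finsupp.single q 1 ≺[m] Finsupp.single p 1) :
    GaussianDAG.IsSquarefreeMonomialIdeal (GaussianDAG.initialIdeal m T.ideal) ∧
      GaussianDAG.PullingUnimodular T.config
        (fun p q => Finsupp.single p.1 1 ≺[m] Finsupp.single q.1 1) := by
  have hconfig := GaussianDAG.isNearlyCompressed_config hT
  have hD : ∀ p ∉ {p : T.TrekPair | p.1.1.1 = p.1.1.2}, ∀ q ∈ {p : T.TrekPair | p.1.1.1 = p.1.1.2},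
      Finsupp.single p.1 1 ≺[m] Finsupp.single q.1 1 := fun p hp q hq => hdiag q.1 p.1 hq hp
  constructor
  · exact hconfig.isSquarefreeMonomialIdeal_initialIdeal GaussianDAG.total_config
      (GaussianDAG.isMonomialMap_phi hT) hm hD
  · exact (hconfig.pullsAtHeightOne GaussianDAG.total_config (fun _ _ h => h.asymm)
      hD).pullingUnimodular GaussianDAG.total_config

open scoped Classical in
theorem mainTheorem9 {n : ℕ} (T : GaussianDAG.DAG n) (hT : T.IsTree)
    (m : MonomialOrder (GaussianDAG.SigmaVar n)) (hm : GaussianDAG.IsRevLex m)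
    (hdiag : ∀ p q : GaussianDAG.SigmaVar n, p.1.1 = p.1.2 → q.1.1 ≠ q.1.2 →
      Finsupp.single q 1 ≺[m] Finsupp.single p 1) :
    GaussianDAG.IsSquarefreeMonomialIdeal (GaussianDAG.initialIdeal m T.ideal) ∧
      GaussianDAG.PullingUnimodular T.config
        (fun p q => Finsupp.single p.1 1 ≺[m] Finsupp.single q.1 1) :=
  mainTheorem9_general T hT.isAcyclic m hm hdiag
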